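/- Corollary. There is an effectively computable absolute constant $0<c<1$ with the following property. Let $\mathbb F_q$ be a finite field with $q$ elements and characteristic $p>2$, let $H$ be a subgroup of the multiplicative group $\mathbb F_q^*$ of index $m=[\mathbb F_q^*:H]$, and, for a positive integer $k$ and $b\in\mathbb F_q$, let $M_H(k,b)$ be the number of $k$-element subsets $S\subseteq H$ with $\sum_{a\in S}a=b$. Suppose that $m<c\sqrt q$ and $k\le \frac{q-1}{2m}$. (1) If $6\ln q<k$, then $M_H(k,b)>0$ for every $b\in\mathbb F_q$; in other words, every element of $\mathbb F_q$ is a sum of $k$ distinct elements of $H$. (2) If only $3\ln(4q)<k$, then $M_H(k,b)>0$ for every $b\in\mathbb F_q^*$. -/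

import Mathlib

/-- `subsetSumCount A k b` is the number `M_A(k, b)` of `k`-element subsets `S ⊆ A`
with `∑_{a ∈ S} a = b`. For a finite field `F` this is the cardinality of a finite set. -/
noncomputable def subsetSumCount {F : Type*} [AddCommMonoid F] (A : Set F) (k : ℕ) (b : F) : ℕ :=
  Set.ncard {S : Finset F | (S : Set F) ⊆ A ∧ S.card = k ∧ ∑ a ∈ S, a = b}

/-- A multiplicative subgroup `H` of `Fˣ`, viewed as a subset of the field `F`. -/
def subgroupCarrier {F : Type*} [Field F] (H : Subgroup Fˣ) : Set F :=
  (fun u : Fˣ => (u : F)) '' (H : Set Fˣ)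

/-- A real number is (effectively) computable if it is the limit of an algorithmically computable
sequence of rationals `num n / (den n + 1)` with the explicit error bound `1 / 2 ^ n`. -/
def IsEffectivelyComputable (x : ℝ) : Prop :=
  ∃ (num : ℕ → ℤ) (den : ℕ → ℕ), Computable num ∧ Computable den ∧
    ∀ n : ℕ, |x - (num n : ℝ) / ((den n : ℝ) + 1)| ≤ 1 / 2 ^ n

/-- Over a finite type, the count is positive exactly when `b` is a sum of `k` distinct
elements of `A`. -/
theorem subsetSumCount_pos_iff {F : Type*} [AddCommMonoid F] [Finite F]
    (A : Set F) (k : ℕ) (b : F) :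
    0 < subsetSumCount A k b ↔
      ∃ S : Finset F, (S : Set F) ⊆ A ∧ S.card = k ∧ ∑ a ∈ S, a = b := by
  unfold subsetSumCount
  rw [Set.ncard_pos (Set.toFinite _)]
  rfl

open Finset

/-! Write `n = |H|`. Count by additive characters: the zero frequency contributes `n.choose k`, and
a frequency `y ≠ 0` contributes the `k`-th elementary symmetric sum of the values `ψ (y * a)`, up to
a unit factor. That sum is a coefficient of `∏ (1 + z * ψ (y * a))`, so Cauchy's estimate on `‖z‖ =
x` bounds it. The Gauss period bound `√q` makes the product at most `((1 + x ^ 2) ^ n * exp (2 * x *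
√q)) ^ (1 / 2)`. For a suitable radius (`exists_radius`), `q` such terms stay below `n.choose k`, so
`b` is reached. -/

theorem div_pow_le_choose {n k : ℕ} (h : k ≤ n) : ((n : ℝ) / k) ^ k ≤ n.choose k := by
  induction k generalizing n with
  | zero => simp
  | succ k ih =>
    obtain ⟨n, rfl⟩ : ∃ n', n = n' + 1 := ⟨n - 1, by omega⟩
    have hkn : k ≤ n := by omega
    have hc : ((n + 1).choose (k + 1) : ℝ) = ((n : ℝ) + 1) / (k + 1) * n.choose k := by
      have := Nat.add_one_mul_choose_eq n k
      have h2 : ((n : ℝ) + 1) * n.choose k = (n + 1).choose (k + 1) * (k + 1) := by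
        exact_mod_cast this
      field_simp
      linarith
    rw [hc, pow_succ']
    push_cast
    rcases Nat.eq_zero_or_pos k with rfl | hk
    · simp
    have hk' : (0 : ℝ) < k := by exact_mod_cast hk
    have hkn' : (k : ℝ) ≤ n := by exact_mod_cast hkn
    have hle : ((n : ℝ) + 1) / (k + 1) ≤ n / k := by
      rw [div_le_div_iff₀ (by positivity) hk']
      nlinarith
    gcongr
    exact (pow_le_pow_left₀ (by positivity) hle k).trans (ih hkn)

theorem choose_le_choose_of_le_half {n j k : ℕ} (hjk : j ≤ k) (hk : 2 * k ≤ n) :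
    n.choose j ≤ n.choose k := by
  induction k, hjk using Nat.le_induction with
  | base => exact le_rfl
  | succ k _ ih => exact (ih (by omega)).trans (Nat.choose_le_succ_of_lt_half_left (by omega))

/-! ### Elementary symmetric sums via Cauchy's estimate -/

/-- Cauchy's coefficient estimate, with the contour integral replaced by an average over roots of
unity. -/
theorem norm_sum_powersetCard_prod_mul_pow_le {ι : Type*} (A : Finset ι) (u : ι → ℂ) (k : ℕ)
    (hk : k ≤ A.card) {x B : ℝ} (hx : 0 ≤ x)
    (h : ∀ z : ℂ, ‖z‖ = x → ‖∏ a ∈ A, (1 + z * u a)‖ ≤ B) :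
    ‖∑ S ∈ A.powersetCard k, ∏ a ∈ S, u a‖ * x ^ k ≤ B := by
  classical
  -- `N` exceeds every subset size, so sizes congruent mod `N` are equal.
  set N := A.card + 1 with hN
  let χ : AddChar (ZMod N) ℂ := ZMod.stdAddChar
  have hχ : χ.IsPrimitive := ZMod.isPrimitive_stdAddChar N
  have key : ∑ j : ZMod N, χ (j * (-(k : ZMod N))) * ∏ a ∈ A, (1 + (x * χ j) * u a)
      = N * (x ^ k * ∑ S ∈ A.powersetCard k, ∏ a ∈ S, u a) := by
    have h1 : ∀ j : ZMod N, χ (j * (-(k : ZMod N))) * ∏ a ∈ A, (1 + (x * χ j) * u a)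
        = ∑ S ∈ A.powerset, (x : ℂ) ^ S.card * (∏ a ∈ S, u a) *
          χ (j * ((S.card : ZMod N) - k)) := by
      intro j
      rw [prod_one_add, mul_sum]
      refine sum_congr rfl fun S _ => ?_
      rw [prod_mul_distrib, prod_const, mul_pow, ← AddChar.map_nsmul_eq_pow, sub_eq_add_neg,
        mul_add, AddChar.map_add_eq_mul, nsmul_eq_mul, mul_comm j (S.card : ZMod N)]
      ring
    simp_rw [h1]
    rw [sum_comm, powersetCard_eq_filter, mul_sum, mul_sum, sum_filter]
    refine sum_congr rfl fun S hS => ?_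
    rw [← mul_sum, AddChar.sum_mulShift _ hχ, ZMod.card]
    have hSA : S.card ≤ A.card := card_le_card (mem_powerset.1 hS)
    have hiff : ((S.card : ZMod N) - k = 0) ↔ S.card = k := by
      rw [sub_eq_zero, ZMod.natCast_eq_natCast_iff]
      refine ⟨fun h => Nat.ModEq.eq_of_lt_of_lt h (by omega) (by omega), fun h => by rw [h]⟩
    by_cases hc : S.card = k
    · rw [if_pos (hiff.2 hc), if_pos hc, hc]
      ring
    · rw [if_neg (hiff.not.2 hc), if_neg hc]
      simp
  have hnorm : ‖(N : ℂ) * (x ^ k * ∑ S ∈ A.powersetCard k, ∏ a ∈ S, u a)‖ ≤ N * B := by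
    rw [← key]
    refine (norm_sum_le _ _).trans ?_
    calc _ ≤ ∑ _j : ZMod N, B := by
          refine sum_le_sum fun j _ => ?_
          rw [norm_mul, AddChar.norm_apply, one_mul]
          refine h _ ?_
          rw [norm_mul, AddChar.norm_apply, Complex.norm_real, Real.norm_of_nonneg hx, mul_one]
      _ = N * B := by simp [ZMod.card]
  rw [norm_mul, norm_mul, norm_pow, Complex.norm_real, Real.norm_of_nonneg hx,
    Complex.norm_natCast] at hnorm
  rw [mul_comm]
  exact le_of_mul_le_mul_left hnorm (by positivity)

/-- Factoring `1 + x ^ 2` out of `‖1 + z * u a‖ ^ 2` and using `1 + t ≤ exp t` leaves only the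
linear sum `∑ u a` in the exponent. -/
theorem norm_prod_one_add_sq_le {ι : Type*} (A : Finset ι) (u : ι → ℂ) (hu : ∀ a, ‖u a‖ = 1)
    {x s : ℝ} (hs : ‖∑ a ∈ A, u a‖ ≤ s) (z : ℂ) (hz : ‖z‖ = x) :
    ‖∏ a ∈ A, (1 + z * u a)‖ ^ 2 ≤ (1 + x ^ 2) ^ A.card * Real.exp (2 * x * s) := by
  have hx : 0 ≤ x := hz ▸ norm_nonneg z
  have h1 : ∀ a, ‖1 + z * u a‖ ^ 2 ≤ (1 + x ^ 2) * Real.exp (2 * (z * u a).re / (1 + x ^ 2)) := by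
    intro a
    have hw : ‖z * u a‖ = x := by rw [norm_mul, hu, hz, mul_one]
    have h2 : ‖1 + z * u a‖ ^ 2 = (1 + x ^ 2) * (2 * (z * u a).re / (1 + x ^ 2) + 1) := by
      rw [← hw]
      have hpos : (0 : ℝ) < 1 + ‖z * u a‖ ^ 2 := by positivity
      field_simp
      rw [Complex.sq_norm, Complex.sq_norm, Complex.normSq_apply, Complex.normSq_apply]
      simp only [Complex.add_re, Complex.add_im, Complex.one_re, Complex.one_im]
      ring
    rw [h2]
    gcongr
    exact Real.add_one_le_exp _
  rw [norm_prod, ← prod_pow]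
  calc ∏ a ∈ A, ‖1 + z * u a‖ ^ 2
      ≤ ∏ a ∈ A, ((1 + x ^ 2) * Real.exp (2 * (z * u a).re / (1 + x ^ 2))) :=
        prod_le_prod (fun _ _ => by positivity) fun a _ => h1 a
    _ = (1 + x ^ 2) ^ A.card * Real.exp (2 * (z * ∑ a ∈ A, u a).re / (1 + x ^ 2)) := by
        rw [prod_mul_distrib, prod_const, ← Real.exp_sum, mul_sum, Complex.re_sum, mul_sum, sum_div]
    _ ≤ _ := by
        gcongr
        have h3 : (z * ∑ a ∈ A, u a).re ≤ x * s := by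
          refine (Complex.re_le_norm _).trans ?_
          rw [norm_mul, hz]
          gcongr
        have h4 : 0 ≤ x * s := mul_nonneg hx ((norm_nonneg _).trans hs)
        rw [div_le_iff₀ (by positivity)]
        nlinarith [mul_nonneg h4 (sq_nonneg x)]

/-! ### Gauss periods -/

/-- The period is constant for frequencies in the coset `yH`, which therefore contributes `|H|`
equal terms to the Parseval total `q * |H|`. -/
theorem norm_sum_subgroup_le {F : Type*} [Field F] [Fintype F] [DecidableEq F] {ψ : AddChar F ℂ}
    (hψ : ψ.IsPrimitive) (H : Subgroup Fˣ) (A : Finset F)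
    (hA : (A : Set F) = (fun u : Fˣ => (u : F)) '' (H : Set Fˣ)) {y : F} (hy : y ≠ 0) :
    ‖∑ a ∈ A, ψ (y * a)‖ ≤ Real.sqrt (Fintype.card F) := by
  have hmem : ∀ a : F, a ∈ A ↔ ∃ u ∈ H, (u : F) = a := fun a => by
    rw [← mem_coe, hA]; rfl
  have h0 : ∀ a ∈ A, a ≠ 0 := fun a ha => by
    obtain ⟨u, -, rfl⟩ := (hmem a).1 ha
    exact u.ne_zero
  have hmul : ∀ a ∈ A, ∀ b ∈ A, a * b ∈ A := fun a ha b hb => by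
    obtain ⟨u, hu, rfl⟩ := (hmem a).1 ha
    obtain ⟨v, hv, rfl⟩ := (hmem b).1 hb
    exact (hmem _).2 ⟨u * v, H.mul_mem hu hv, by simp⟩
  have hApos : 0 < A.card := card_pos.2 ⟨1, (hmem 1).2 ⟨1, H.one_mem, rfl⟩⟩
  have hinv : ∀ h ∈ A, ∑ a ∈ A, ψ (y * h * a) = ∑ a ∈ A, ψ (y * a) := by
    intro h hh
    have himg : A.image (h * ·) = A := by
      apply eq_of_subset_of_card_le
      · intro b hb
        obtain ⟨a, ha, rfl⟩ := mem_image.1 hb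
        exact hmul h hh a ha
      · rw [card_image_of_injective _ (mul_right_injective₀ (h0 h hh))]
    conv_rhs => rw [← himg]
    rw [sum_image (fun a _ b _ hab => mul_right_injective₀ (h0 h hh) hab)]
    simp only [mul_assoc]
  have htot : ∑ w : F, ‖∑ a ∈ A, ψ (w * a)‖ ^ 2 = Fintype.card F * A.card := by
    have hc : ((∑ w : F, ‖∑ a ∈ A, ψ (w * a)‖ ^ 2 : ℝ) : ℂ)
        = ((Fintype.card F * A.card : ℝ) : ℂ) := by
      push_cast
      have h1 : ∀ w : F, ((‖∑ a ∈ A, ψ (w * a)‖ : ℂ)) ^ 2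
          = ∑ a ∈ A, ∑ b ∈ A, ψ (w * (a - b)) := by
        intro w
        rw [← Complex.mul_conj', map_sum, sum_mul_sum]
        refine sum_congr rfl fun a _ => sum_congr rfl fun b _ => ?_
        rw [← AddChar.map_neg_eq_conj, ← AddChar.map_add_eq_mul]
        congr 1
        ring
      simp_rw [h1]
      rw [sum_comm]
      simp_rw [sum_comm (s := (univ : Finset F)), AddChar.sum_mulShift _ hψ, sub_eq_zero]
      simp [sum_ite_eq, mul_comm]
    exact_mod_cast hc
  have hsub : ∑ h ∈ A, ‖∑ a ∈ A, ψ (y * h * a)‖ ^ 2 ≤ ∑ w : F, ‖∑ a ∈ A, ψ (w * a)‖ ^ 2 := by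
    rw [← sum_image (s := A) (g := (y * ·)) (f := fun w => ‖∑ a ∈ A, ψ (w * a)‖ ^ 2)
      (fun a _ b _ hab => mul_right_injective₀ hy hab)]
    exact sum_le_sum_of_subset_of_nonneg (subset_univ _) fun _ _ _ => by positivity
  rw [htot, sum_congr rfl fun h hh => by rw [hinv h hh], sum_const, nsmul_eq_mul, mul_comm] at hsub
  exact Real.le_sqrt_of_sq_le (le_of_mul_le_mul_right hsub (by exact_mod_cast hApos))

/-! ### Choice of the radius -/

theorem pow_four_lt_exp {t : ℝ} (ht : 0 ≤ t) : t ^ 4 < Real.exp (4 * t) := by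
  have h : t < Real.exp t := by linarith [Real.add_one_le_exp t]
  calc t ^ 4 < Real.exp t ^ 4 := pow_lt_pow_left₀ h ht (by norm_num)
    _ = Real.exp (4 * t) := by rw [← Real.exp_nat_mul]; norm_num

theorem one_add_sq_pow_le_exp (x : ℝ) (n : ℕ) : (1 + x ^ 2) ^ n ≤ Real.exp (n * x ^ 2) := by
  rw [Real.exp_nat_mul]
  gcongr
  linarith [Real.add_one_le_exp (x ^ 2)]

theorem pow_le_choose_mul_pow {n k : ℕ} (hk : 0 < k) (hkn : k ≤ n) {r : ℝ} (hr : 0 ≤ r) :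
    r ^ k ≤ n.choose k * (r * k / n) ^ k := by
  have hk' : (0 : ℝ) < k := by exact_mod_cast hk
  have hn' : (0 : ℝ) < n := by exact_mod_cast hk.trans_le hkn
  calc r ^ k = ((n : ℝ) / k) ^ k * (r * k / n) ^ k := by
        rw [← mul_pow]; congr 1; field_simp
    _ ≤ _ := by gcongr; exact div_pow_le_choose hkn

theorem exists_radius_of_le_ninth {n k : ℕ} {s : ℝ} (hk : 0 < k) (hkn : 9 * k ≤ n) (hs : 1 ≤ s)
    (hsn : 1000 * s ≤ n) (hq : 4 * s ^ 2 < Real.exp (k / 3)) :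
    ∃ x : ℝ, 0 < x ∧
      (s ^ 2) ^ 2 * ((1 + x ^ 2) ^ n * Real.exp (2 * x * s)) < (n.choose k * x ^ k) ^ 2 := by
  have hk' : (0 : ℝ) < k := by exact_mod_cast hk
  have hn' : (0 : ℝ) < n := by linarith
  have hkn' : (9 : ℝ) * k ≤ n := by exact_mod_cast hkn
  -- With this radius the left side is below `exp (2 * k)`, and `e < 3` finishes.
  refine ⟨3 * k / n, by positivity, ?_⟩
  set x : ℝ := 3 * k / n with hx
  have hxn : x * n = 3 * k := by rw [hx]; field_simp
  have hx0 : 0 < x := by positivity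
  have hx3 : x ≤ 1 / 3 := by rw [hx, div_le_iff₀ hn']; linarith
  have h1 : n * x ^ 2 ≤ k := by nlinarith
  have h2 : 2 * x * s ≤ k / 3 := by nlinarith
  have hq' : s ^ 2 < Real.exp (k / 3) := by nlinarith [sq_nonneg s]
  calc (s ^ 2) ^ 2 * ((1 + x ^ 2) ^ n * Real.exp (2 * x * s))
      ≤ (s ^ 2) ^ 2 * (Real.exp k * Real.exp (k / 3)) := by
        gcongr
        exact (one_add_sq_pow_le_exp x n).trans (Real.exp_le_exp.2 h1)
    _ < Real.exp (k / 3) ^ 2 * (Real.exp k * Real.exp (k / 3)) := by gcongr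
    _ = (Real.exp 1 ^ k) ^ 2 := by
        simp only [← Real.exp_nat_mul, ← Real.exp_add]
        congr 1; push_cast; ring
    _ ≤ (3 ^ k) ^ 2 := by
        gcongr
        exact Real.exp_one_lt_three.le
    _ ≤ _ := by
        gcongr
        exact pow_le_choose_mul_pow hk (by omega) (by norm_num)

theorem exists_radius_of_le_third {n k : ℕ} {s : ℝ} (hk : 0 < k) (hnk : n ≤ 9 * k)
    (hkn : 3 * k ≤ n) (hs : 1 ≤ s) (hsn : 1000 * s ≤ n) :
    ∃ x : ℝ, 0 < x ∧
      (s ^ 2) ^ 2 * ((1 + x ^ 2) ^ n * Real.exp (2 * x * s)) < (n.choose k * x ^ k) ^ 2 := by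
  have hk' : (0 : ℝ) < k := by exact_mod_cast hk
  have hn' : (0 : ℝ) < n := by linarith
  have hkn' : (3 : ℝ) * k ≤ n := by exact_mod_cast hkn
  have hnk' : (n : ℝ) ≤ 9 * k := by exact_mod_cast hnk
  -- Now `k` is at least of order `s`, so `s ^ 4` costs only a small exponential in `k`; the total
  -- exponent stays below `11 / 10 * k`, and `exp (11 / 10) ≤ (7 / 4) ^ 2`.
  refine ⟨7 / 4 * k / n, by positivity, ?_⟩
  set x : ℝ := 7 / 4 * k / n with hx
  have hxn : x * n = 7 / 4 * k := by rw [hx]; field_simp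
  have hx0 : 0 < x := by positivity
  have hx3 : x ≤ 7 / 12 := by rw [hx, div_le_iff₀ hn']; linarith
  have h1 : n * x ^ 2 ≤ 49 / 48 * k := by nlinarith
  have h2 : 2 * x * s ≤ 7 / 2000 * k := by nlinarith
  have hq' : (s ^ 2) ^ 2 < Real.exp (4 * (9 / 1000 * k)) := by
    rw [← pow_mul]
    refine lt_of_le_of_lt ?_ (pow_four_lt_exp (by positivity))
    gcongr
    linarith
  have he : Real.exp (11 / 10) ≤ (7 / 4) ^ 2 := by
    refine le_of_pow_le_pow_left₀ (n := 10) (by norm_num) (by positivity) ?_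
    rw [← Real.exp_nat_mul]
    calc Real.exp ((10 : ℕ) * (11 / 10)) = Real.exp 1 ^ 11 := by
          rw [← Real.exp_nat_mul]; norm_num
      _ ≤ 2.7182818286 ^ 11 := by gcongr; exact Real.exp_one_lt_d9.le
      _ ≤ _ := by norm_num
  calc (s ^ 2) ^ 2 * ((1 + x ^ 2) ^ n * Real.exp (2 * x * s))
      ≤ (s ^ 2) ^ 2 * (Real.exp (49 / 48 * k) * Real.exp (7 / 2000 * k)) := by
        gcongr
        exact (one_add_sq_pow_le_exp x n).trans (Real.exp_le_exp.2 h1)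
    _ < Real.exp (4 * (9 / 1000 * k)) *
          (Real.exp (49 / 48 * k) * Real.exp (7 / 2000 * k)) := by gcongr
    _ ≤ Real.exp (11 / 10) ^ k := by
        simp only [← Real.exp_nat_mul, ← Real.exp_add]
        apply Real.exp_le_exp.2
        linarith
    _ ≤ ((7 / 4) ^ 2) ^ k := by gcongr
    _ = ((7 / 4) ^ k) ^ 2 := by rw [← pow_mul, ← pow_mul, mul_comm]
    _ ≤ _ := by
        gcongr
        exact pow_le_choose_mul_pow hk (by omega) (by norm_num)

theorem exists_radius_of_third_le {n k : ℕ} {s : ℝ} (hnk : n ≤ 3 * k) (hkn : 2 * k ≤ n)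
    (hs : 1 ≤ s) (hsn : 1000 * s ≤ n) :
    ∃ x : ℝ, 0 < x ∧
      (s ^ 2) ^ 2 * ((1 + x ^ 2) ^ n * Real.exp (2 * x * s)) < (n.choose k * x ^ k) ^ 2 := by
  -- Near the middle, with `j = n / 3`, `(n.choose k) ^ 2 ≥ 9 ^ j` beats `2 ^ n ≤ 4 * 8 ^ j`; the
  -- ratio `(9 / 8) ^ j` absorbs the rest.
  refine ⟨1, one_pos, ?_⟩
  obtain ⟨j, hj, hj'⟩ : ∃ j, 3 * j ≤ n ∧ n ≤ 3 * j + 2 := ⟨n / 3, by omega, by omega⟩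
  have hn : 1000 ≤ n := by
    have : (1000 : ℝ) ≤ n := by linarith
    exact_mod_cast this
  have hn3 : (n : ℝ) ≤ 3 * j + 2 := by exact_mod_cast hj'
  have hj0 : (332 : ℝ) ≤ j := by
    have : 332 ≤ j := by omega
    exact_mod_cast this
  have hsj : s ≤ 4 / 1000 * j := by linarith
  have hC : (3 : ℝ) ^ j ≤ n.choose k := by
    calc (3 : ℝ) ^ j ≤ ((n : ℝ) / j) ^ j := by
          gcongr
          rw [le_div_iff₀ (by linarith)]
          exact_mod_cast hj
      _ ≤ n.choose j := div_pow_le_choose (by omega)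
      _ ≤ n.choose k := by exact_mod_cast choose_le_choose_of_le_half (by omega) hkn
  have h2 : (2 : ℝ) ^ n ≤ 4 * 8 ^ j := by
    calc (2 : ℝ) ^ n ≤ 2 ^ (3 * j + 2) := by gcongr; norm_num
      _ = 4 * 8 ^ j := by rw [pow_add, pow_mul]; norm_num; ring
  have hq' : (s ^ 2) ^ 2 * 4 ≤ Real.exp (4 * (8 / 1000 * j)) := by
    refine le_trans ?_ (pow_four_lt_exp (by positivity)).le
    calc (s ^ 2) ^ 2 * 4 = s ^ 4 * 4 := by ring
      _ ≤ (4 / 1000 * (j : ℝ)) ^ 4 * 16 := by gcongr; norm_num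
      _ = _ := by ring
  have he : Real.exp (1 / 10) ≤ 9 / 8 := by
    refine le_of_pow_le_pow_left₀ (n := 10) (by norm_num) (by positivity) ?_
    rw [← Real.exp_nat_mul]
    calc Real.exp ((10 : ℕ) * (1 / 10)) = Real.exp 1 := by norm_num
      _ ≤ 3 := Real.exp_one_lt_three.le
      _ ≤ _ := by norm_num
  calc (s ^ 2) ^ 2 * ((1 + 1 ^ 2) ^ n * Real.exp (2 * 1 * s))
      ≤ (s ^ 2) ^ 2 * (4 * 8 ^ j * Real.exp (8 / 1000 * j)) := by
        rw [one_pow, one_add_one_eq_two]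
        have h3 : Real.exp (2 * 1 * s) ≤ Real.exp (8 / 1000 * j) :=
          Real.exp_le_exp.2 (by linarith)
        gcongr
    _ = (s ^ 2) ^ 2 * 4 * Real.exp (8 / 1000 * j) * 8 ^ j := by ring
    _ ≤ Real.exp (4 * (8 / 1000 * j)) * Real.exp (8 / 1000 * j) * 8 ^ j := by gcongr
    _ < Real.exp (1 / 10) ^ j * 8 ^ j := by
        rw [← Real.exp_nat_mul, ← Real.exp_add]
        gcongr
        linarith
    _ ≤ (9 / 8) ^ j * 8 ^ j := by gcongr
    _ = (3 ^ j) ^ 2 := by rw [← mul_pow, ← pow_mul, mul_comm j, pow_mul]; norm_num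
    _ ≤ _ := by rw [one_pow, mul_one]; gcongr

theorem exists_radius {n k : ℕ} {s : ℝ} (hk : 0 < k) (hkn : 2 * k ≤ n) (hs : 1 ≤ s)
    (hsn : 1000 * s ≤ n) (hq : 4 * s ^ 2 < Real.exp (k / 3)) :
    ∃ x : ℝ, 0 < x ∧
      (s ^ 2) ^ 2 * ((1 + x ^ 2) ^ n * Real.exp (2 * x * s)) < (n.choose k * x ^ k) ^ 2 := by
  rcases le_total (9 * k) n with h9 | h9
  · exact exists_radius_of_le_ninth hk h9 hs hsn hq
  rcases le_total (3 * k) n with h3 | h3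
  · exact exists_radius_of_le_third hk h9 h3 hs hsn
  · exact exists_radius_of_third_le h3 hkn hs hsn

/-! ### Character counting and conclusion -/

theorem addChar_mul_sum {F : Type*} [CommRing F] (ψ : AddChar F ℂ) (y : F) (S : Finset F) :
    ψ (y * ∑ a ∈ S, a) = ∏ a ∈ S, ψ (y * a) := by
  classical
  induction S using Finset.induction_on with
  | empty => simp
  | insert a S ha ih => rw [sum_insert ha, prod_insert ha, mul_add, AddChar.map_add_eq_mul, ih]

/-- If no `k`-subset of `A` sums to `b`, then some nonzero frequency carries an elementary
symmetric sum which is not much smaller than the binomial coefficient. -/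
theorem choose_le_of_forall_sum_ne {F : Type*} [Field F] [Fintype F] [DecidableEq F]
    {ψ : AddChar F ℂ} (hψ : ψ.IsPrimitive) (A : Finset F) (k : ℕ) (b : F)
    (hb : ∀ S ∈ A.powersetCard k, ∑ a ∈ S, a ≠ b) {E : ℝ} (hE : 0 ≤ E)
    (h : ∀ y : F, y ≠ 0 → ‖∑ S ∈ A.powersetCard k, ∏ a ∈ S, ψ (y * a)‖ ≤ E) :
    (A.card.choose k : ℝ) ≤ Fintype.card F * E := by
  have hzero : ∑ y : F, ψ (y * -b) * ∑ S ∈ A.powersetCard k, ∏ a ∈ S, ψ (y * a) = 0 := by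
    simp_rw [mul_sum, ← addChar_mul_sum, ← AddChar.map_add_eq_mul, ← mul_add]
    rw [sum_comm]
    refine sum_eq_zero fun S hS => ?_
    rw [AddChar.sum_mulShift _ hψ, if_neg, Nat.cast_zero]
    rw [neg_add_eq_zero]
    exact (hb S hS).symm
  rw [← add_sum_erase _ _ (mem_univ (0 : F))] at hzero
  simp only [zero_mul, AddChar.map_zero_eq_one, prod_const_one, sum_const, card_powersetCard,
    nsmul_eq_mul, mul_one, one_mul] at hzero
  rw [← Complex.norm_natCast, eq_neg_of_add_eq_zero_left hzero, norm_neg]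
  refine (norm_sum_le _ _).trans ?_
  calc _ ≤ ∑ _y ∈ univ.erase (0 : F), E := by
        refine sum_le_sum fun y hy => ?_
        rw [norm_mul, AddChar.norm_apply, one_mul]
        exact h y (ne_of_mem_erase hy)
    _ ≤ ∑ _y : F, E := sum_le_sum_of_subset_of_nonneg (subset_univ _) fun _ _ _ => hE
    _ = _ := by simp

theorem exists_subset_sum_eq {F : Type*} [Field F] [Fintype F] (H : Subgroup Fˣ) {k : ℕ}
    (hH : 1000 * Real.sqrt (Fintype.card F) ≤ Nat.card H) (hk : 0 < k) (hkH : 2 * k ≤ Nat.card H)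
    (hq : 4 * (Fintype.card F : ℝ) < Real.exp (k / 3)) (b : F) :
    ∃ S : Finset F, (S : Set F) ⊆ subgroupCarrier H ∧ S.card = k ∧ ∑ a ∈ S, a = b := by
  classical
  by_contra! hcon
  set s := Real.sqrt (Fintype.card F) with hs
  have hs2 : s ^ 2 = Fintype.card F := Real.sq_sqrt (by positivity)
  have hs1 : 1 ≤ s := by
    rw [hs, Real.one_le_sqrt]
    exact_mod_cast Fintype.card_pos
  set A : Finset F := (Set.toFinite (subgroupCarrier H)).toFinset with hAdef
  have hA : (A : Set F) = subgroupCarrier H := Set.Finite.coe_toFinset _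
  have hcard : A.card = Nat.card H := by
    rw [← Set.ncard_coe_finset, hA, subgroupCarrier, Set.ncard_image_of_injective _ Units.val_injective]
    rfl
  obtain ⟨x, hx, hlt⟩ := exists_radius hk hkH hs1 hH (by rwa [hs2])
  rw [← hcard] at hlt hkH
  set R := (1 + x ^ 2) ^ A.card * Real.exp (2 * x * s) with hR
  have hR0 : 0 ≤ R := by positivity
  have hψ := AddChar.FiniteField.primitiveChar_to_Complex_isPrimitive F
  have hle := choose_le_of_forall_sum_ne hψ A k b
    (fun S hS => hcon S (by rw [← hA]; exact_mod_cast (mem_powersetCard.1 hS).1)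
      (mem_powersetCard.1 hS).2) (E := Real.sqrt R / x ^ k) (by positivity) (by
      intro y hy
      rw [le_div_iff₀ (by positivity)]
      refine norm_sum_powersetCard_prod_mul_pow_le A _ k (by omega) hx.le fun z hz => ?_
      exact Real.le_sqrt_of_sq_le (norm_prod_one_add_sq_le A _
        (fun a => AddChar.norm_apply _ _) (norm_sum_subgroup_le hψ H A hA hy) z hz))
  rw [← mul_div_assoc, le_div_iff₀ (by positivity), ← hs2] at hle
  have := pow_le_pow_left₀ (by positivity) hle 2
  rw [mul_pow (s ^ 2), Real.sq_sqrt hR0] at this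
  linarith

theorem isEffectivelyComputable_one_div (d : ℕ) : IsEffectivelyComputable (1 / ((d : ℝ) + 1)) :=
  ⟨fun _ => 1, fun _ => d, Computable.const _, Computable.const _, fun n => by simp⟩

theorem mainTheorem3 :
    ∃ c : ℝ, 0 < c ∧ c < 1 ∧ IsEffectivelyComputable c ∧
      ∀ (F : Type*) [Field F] [Fintype F] (p q m k : ℕ) (H : Subgroup Fˣ),
        CharP F p → 2 < p → Fintype.card F = q → H.index = m →
        (m : ℝ) < c * Real.sqrt q →
        (k : ℝ) ≤ ((q : ℝ) - 1) / (2 * (m : ℝ)) →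
        (6 * Real.log q < (k : ℝ) →
          ∀ b : F, 0 < subsetSumCount (subgroupCarrier H) k b) ∧
        (3 * Real.log (4 * (q : ℝ)) < (k : ℝ) →
          ∀ b : F, b ≠ 0 → 0 < subsetSumCount (subgroupCarrier H) k b) := by
  refine ⟨1 / ((1999 : ℕ) + 1), by norm_num, by norm_num,
    isEffectivelyComputable_one_div 1999, ?_⟩
  intro F _ _ p q m k H _ _ hq hm hmq hk
  classical
  set s := Real.sqrt q with hs
  have hs2 : s ^ 2 = q := Real.sq_sqrt (by positivity)
  have hm1 : (1 : ℝ) ≤ m := by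
    have : H.index ≠ 0 := Subgroup.index_ne_zero_of_finite
    exact_mod_cast (by omega : 1 ≤ m)
  norm_num at hmq
  have hs4 : 2000 < s := by linarith
  have hmn : (m : ℝ) * Nat.card H = q - 1 := by
    have h := H.index_mul_card
    rw [hm, Nat.card_eq_fintype_card (α := Fˣ), Fintype.card_units, hq] at h
    have hq1 : 1 ≤ q := hq ▸ Fintype.card_pos
    rw [← Nat.cast_one, ← Nat.cast_sub hq1, ← h]
    push_cast
    rfl
  -- Otherwise `m < s / 2000` would give `q - 1 = m * |H| < q / 2`.
  have hn : 1000 * s ≤ Nat.card H := by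
    by_contra! hlt
    nlinarith [(Nat.cast_nonneg (Nat.card H) : (0 : ℝ) ≤ _)]
  have hkn : 2 * k ≤ Nat.card H := by
    rw [le_div_iff₀ (by positivity), ← hmn] at hk
    have : (2 : ℝ) * k ≤ Nat.card H := by
      refine le_of_mul_le_mul_left ?_ (by linarith : (0 : ℝ) < m)
      linarith
    exact_mod_cast this
  have hq4 : (4 : ℝ) ≤ q := by nlinarith
  have main : 3 * Real.log (4 * (q : ℝ)) < k →
      ∀ b : F, 0 < subsetSumCount (subgroupCarrier H) k b := by
    intro hlog b
    have hk0 : 0 < k := by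
      have := Real.log_pos (by linarith : (1 : ℝ) < 4 * q)
      exact_mod_cast (by linarith : (0 : ℝ) < k)
    rw [subsetSumCount_pos_iff]
    refine exists_subset_sum_eq H (by rwa [hq]) hk0 hkn ?_ b
    rw [hq, ← Real.log_lt_iff_lt_exp (by linarith)]
    linarith
  -- As `4 ≤ q`, `log (4 * q) ≤ 2 * log q`.
  refine ⟨fun h6 => main (lt_of_le_of_lt ?_ h6), fun h3 b _ => main h3 b⟩
  rw [Real.log_mul (by norm_num) (by linarith)]
  linarith [Real.log_le_log (by norm_num) hq4]
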